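/- Let $A\in M_2(\mathbb C)$ and write $A=H+Si$ with $H,S\in M_2(\mathbb C)$ Hermitian (in particular, $S$ may be real diagonal). Let $\mathbb H$ denote the Hamilton quaternions. For $\mathbb F\in\{\mathbb C,\mathbb H\}$ and $M\in M_2(\mathbb F)$ let $$W_{\mathbb F}(M)=\{x^*Mx : x\in\mathbb F^2,\ x^*x=1\}$$ be the numerical range of $M$ over $\mathbb F$. Let $\mathbb C^+=\{z\in\mathbb C:\operatorname{Im} z\ge 0\}$ and put $W_{\mathbb C}^+(M)=W_{\mathbb C}(M)\cap\mathbb C^+$ for $M\in M_2(\mathbb C)$. Regard $\mathbb C$ as the subset $\operatorname{span}_{\mathbb R}\{1,i\}$ of $\mathbb H$ and let $B^+(A)=W_{\mathbb H}(A)\cap\mathbb C^+$ be the upper bild of $A$. The Hermitian matrix $S$ is called indefinite if there are unit vectors $x,y\in\mathbb C^2$ with $x^*Sx>0$ and $y^*Sy<0$. Write $\operatorname{conv}$ for the convex hull. Then: (i) if $S$ is indefinite, then $B^+(A)=\operatorname{conv}\big(W_{\mathbb C}^+(A)\cup W_{\mathbb C}^+(A^*)\big)$; (ii) if $S$ is positive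 definite, then there is a real number $v$ such that $B^+(A)=\operatorname{conv}\big(W_{\mathbb C}^+(A)\cup\{v\}\big)$; (iii) if $S$ is positive semidefinite but not positive definite, then $B^+(A)=W_{\mathbb C}^+(A)$. -/

import Mathlib

open scoped ComplexOrder

noncomputable section

namespace QuatNumRange

/-- The numerical range of a square matrix `A` over `R` (below, `R` is `ℂ` or the Hamilton
quaternions): the set of all `x* A x`, where `x` runs over the column vectors with
`x* x = ∑ i, star (x i) * x i = 1`, that is, over the unit sphere. -/
def numericalRange {n R : Type*} [Fintype n] [Ring R] [StarRing R] (A : Matrix n n R) : Set R :=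
  {w | ∃ x : n → R, star x ⬝ᵥ x = 1 ∧ star x ⬝ᵥ A.mulVec x = w}

/-- The closed upper half plane. -/
def closedUpperHalfPlane : Set ℂ := {z | 0 ≤ z.im}

/-- The upper part of the complex numerical range. -/
def upperNumericalRange {n : Type*} [Fintype n] (A : Matrix n n ℂ) : Set ℂ :=
  numericalRange A ∩ closedUpperHalfPlane

/-- A complex matrix regarded as a quaternionic matrix, through `a + b i ↦ a + b i + 0 j + 0 k`. -/
def toQuaternionMatrix {n : Type*} (A : Matrix n n ℂ) : Matrix n n (Quaternion ℝ) :=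
  A.map Quaternion.coeComplex

/-- The bild of a quaternionic matrix: the intersection of its quaternionic numerical range with
the complex plane, as a subset of `ℂ`. -/
def bild {n : Type*} [Fintype n] (A : Matrix n n (Quaternion ℝ)) : Set ℂ :=
  Quaternion.coeComplex ⁻¹' numericalRange A

/-- The upper bild of a quaternionic matrix. -/
def upperBild {n : Type*} [Fintype n] (A : Matrix n n (Quaternion ℝ)) : Set ℂ :=
  bild A ∩ closedUpperHalfPlane

/-- A Hermitian matrix is indefinite if its quadratic form takes both a positive and a negative
value on the unit sphere (the values are real, since the matrix is Hermitian). -/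
def IsIndefinite {n : Type*} [Fintype n] (S : Matrix n n ℂ) : Prop :=
  S.IsHermitian ∧
    (∃ x : n → ℂ, star x ⬝ᵥ x = 1 ∧ 0 < (star x ⬝ᵥ S.mulVec x).re) ∧
    ∃ y : n → ℂ, star y ⬝ᵥ y = 1 ∧ (star y ⬝ᵥ S.mulVec y).re < 0

end QuatNumRange

end

/-!
Write a quaternionic vector as `x = y + z j` with complex vectors `y`, `z`, and let `X` be the
matrix with columns `y`, `z`. For `A = H + i S`, the number `x* A x` is complex exactly when
`y* S z = 0`, that is, when `Xᴴ S X` is diagonal, and then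
`x* A x = tr (H X Xᴴ) + i (y* S y - z* S z)`. Only the density matrix `G = X Xᴴ` matters here: `G`
has a factorization for which `Xᴴ S X` is diagonal, and the squared difference of the diagonal
entries is the discriminant `tr (S G) ^ 2 - 4 det S det G`. So the upper bild consists of the `w`
in the upper half plane with `re w = tr (H G)` and `(im w) ^ 2 = tr (S G) ^ 2 - 4 det S det G` for
a density matrix `G` (`mem_upperBild_iff_exists_posSemidef`), while the complex numerical range
consists of the numbers `tr (A G)` (`mem_numericalRange_iff_exists_posSemidef`, which contains the
Toeplitz–Hausdorff theorem).

* If `S` is semidefinite and singular, the discriminant is `tr (S G) ^ 2`, and both sets agree.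
* If `S` is indefinite, `det S < 0` forces `y* S y ≥ 0 ≥ z* S z`, which gives one inclusion. For the
  other one, for a point of the convex hull the evident density matrix has too large a discriminant,
  a rank-one density matrix with the same traces has too small a one, and a density matrix between
  the two is right (`subset_upperBild_of_isIndefinite`).
* If `S` is positive definite, `y* S z = 0` makes `z z*` a combination of `y y*` and `adj S`
  (`det_mul_trace_mul_adjugate`), so that every point of the upper bild lies on a segment from a
  point of the numerical range to `v = tr (H adj S) / tr S`; conversely every such point is reached.
-/

open Matrix Quaternion

namespace QuatNumRange

/-! ### Quaternionic vectors as pairs of complex vectors -/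

/-- The quaternion unit `j`. Every quaternion is `a + b j` with `a`, `b` complex, and
`j c = conj c * j` for complex `c`. -/
def quaternionJ : ℍ[ℝ] := ⟨0, 0, 1, 0⟩

@[simp] theorem re_quaternionJ : quaternionJ.re = 0 := rfl
@[simp] theorem imI_quaternionJ : quaternionJ.imI = 0 := rfl
@[simp] theorem imJ_quaternionJ : quaternionJ.imJ = 1 := rfl
@[simp] theorem imK_quaternionJ : quaternionJ.imK = 0 := rfl

theorem exists_eq_add_mul_quaternionJ (q : ℍ[ℝ]) :
    ∃ a b : ℂ, q = (a : ℍ[ℝ]) + (b : ℍ[ℝ]) * quaternionJ := by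
  refine ⟨⟨q.re, q.imI⟩, ⟨q.imJ, q.imK⟩, ?_⟩
  ext <;> simp

theorem add_mul_quaternionJ_eq_coe_iff (a b w : ℂ) :
    (a : ℍ[ℝ]) + (b : ℍ[ℝ]) * quaternionJ = (w : ℍ[ℝ]) ↔ a = w ∧ b = 0 := by
  rw [Quaternion.ext_iff]
  simp [Complex.ext_iff, and_assoc]

theorem star_mul_coe_mul_add_mul_quaternionJ (a b c d m : ℂ) :
    star ((a : ℍ[ℝ]) + (b : ℍ[ℝ]) * quaternionJ) *
        ((m : ℍ[ℝ]) * ((c : ℍ[ℝ]) + (d : ℍ[ℝ]) * quaternionJ)) =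
      ((star a * (m * c) + star (star b * (m * d)) : ℂ) : ℍ[ℝ]) +
        ((star a * (m * d) - star (star b * (m * c)) : ℂ) : ℍ[ℝ]) * quaternionJ := by
  ext <;> simp <;> ring

/-- For `x = y + z j`, the complex part of `x* A x` is `y* A y + z* Aᴴ z` (as the conjugate of
`z* A z`), and its `j`-part is `y* A z - conj (z* A y)`. -/
theorem star_dotProduct_toQuaternionMatrix_mulVec {n : Type*} [Fintype n] (A : Matrix n n ℂ)
    (y z : n → ℂ) (x : n → ℍ[ℝ])
    (hx : ∀ i, x i = (y i : ℍ[ℝ]) + (z i : ℍ[ℝ]) * quaternionJ) :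
    star x ⬝ᵥ (toQuaternionMatrix A).mulVec x =
      ((star y ⬝ᵥ A.mulVec y + star (star z ⬝ᵥ A.mulVec z) : ℂ) : ℍ[ℝ]) +
        ((star y ⬝ᵥ A.mulVec z - star (star z ⬝ᵥ A.mulVec y) : ℂ) : ℍ[ℝ]) * quaternionJ := by
  have hs (f : n → ℂ) : ((∑ i, f i : ℂ) : ℍ[ℝ]) = ∑ i, (f i : ℍ[ℝ]) :=
    map_sum Quaternion.ofComplex f Finset.univ
  simp only [dotProduct, mulVec, Finset.mul_sum, star_sum, ← Finset.sum_add_distrib,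
    ← Finset.sum_sub_distrib, hs, Finset.sum_mul, toQuaternionMatrix, Matrix.map_apply,
    Pi.star_apply]
  refine Finset.sum_congr rfl fun i _ => Finset.sum_congr rfl fun k _ => ?_
  rw [hx, hx, star_mul_coe_mul_add_mul_quaternionJ]

/-- The bild of a complex matrix in terms of complex vectors: the condition that `x* A x` be
complex, for `x = y + z j`, is `y* (A - Aᴴ) z = 0`. -/
theorem mem_bild_toQuaternionMatrix_iff {n : Type*} [Fintype n] (A : Matrix n n ℂ) (w : ℂ) :
    w ∈ bild (toQuaternionMatrix A) ↔ ∃ y z : n → ℂ, star y ⬝ᵥ y + star z ⬝ᵥ z = 1 ∧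
      star y ⬝ᵥ (A - Aᴴ).mulVec z = 0 ∧ star y ⬝ᵥ A.mulVec y + star z ⬝ᵥ Aᴴ.mulVec z = w := by
  classical
  have hstar (u v : n → ℂ) : star (star u ⬝ᵥ A.mulVec v) = star v ⬝ᵥ Aᴴ.mulVec u := by
    rw [star_dotProduct, star_star, star_mulVec, dotProduct_mulVec]
  have hone (y z : n → ℂ) (x : n → ℍ[ℝ])
      (hx : ∀ i, x i = (y i : ℍ[ℝ]) + (z i : ℍ[ℝ]) * quaternionJ) :
      star x ⬝ᵥ x = 1 ↔ star y ⬝ᵥ y + star z ⬝ᵥ z = 1 := by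
    have h := star_dotProduct_toQuaternionMatrix_mulVec 1 y z x hx
    have h1 : toQuaternionMatrix (1 : Matrix n n ℂ) = 1 :=
      Matrix.map_one _ (by ext <;> simp) (by ext <;> simp)
    have hz : star (star z ⬝ᵥ z) = star z ⬝ᵥ z :=
      (star_dotProduct z z).symm
    have hzy : star (star z ⬝ᵥ y) = star y ⬝ᵥ z :=
      (star_dotProduct y z).symm
    rw [h1, one_mulVec, one_mulVec, one_mulVec, hz, hzy, sub_self] at h
    rw [h, show (1 : ℍ[ℝ]) = ((1 : ℂ) : ℍ[ℝ]) by ext <;> simp, add_mul_quaternionJ_eq_coe_iff]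
    simp
  have hval (y z : n → ℂ) (x : n → ℍ[ℝ])
      (hx : ∀ i, x i = (y i : ℍ[ℝ]) + (z i : ℍ[ℝ]) * quaternionJ) :
      star x ⬝ᵥ (toQuaternionMatrix A).mulVec x = (w : ℍ[ℝ]) ↔
        star y ⬝ᵥ (A - Aᴴ).mulVec z = 0 ∧
          star y ⬝ᵥ A.mulVec y + star z ⬝ᵥ Aᴴ.mulVec z = w := by
    rw [star_dotProduct_toQuaternionMatrix_mulVec A y z x hx, add_mul_quaternionJ_eq_coe_iff,
      hstar, hstar, sub_mulVec, dotProduct_sub, and_comm]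
  constructor
  · rintro ⟨x, h1, hw⟩
    choose y z hx using fun i => exists_eq_add_mul_quaternionJ (x i)
    exact ⟨y, z, (hone y z x hx).1 h1, (hval y z x hx).1 hw⟩
  · rintro ⟨y, z, h1, hw⟩
    exact ⟨fun i => (y i : ℍ[ℝ]) + (z i : ℍ[ℝ]) * quaternionJ, (hone y z _ fun _ => rfl).2 h1,
      (hval y z _ fun _ => rfl).2 hw⟩

/-! ### The numerical range of a complex matrix and density matrices -/

theorem trace_mul_vecMulVec_star {n : Type*} [Fintype n] (A : Matrix n n ℂ) (e : n → ℂ) :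
    (A * vecMulVec e (star e)).trace = star e ⬝ᵥ A.mulVec e := by
  rw [mul_vecMulVec, trace_vecMulVec, dotProduct_comm]

theorem trace_vecMulVec_star {n : Type*} [Fintype n] (e : n → ℂ) :
    (vecMulVec e (star e)).trace = star e ⬝ᵥ e := by
  rw [trace_vecMulVec, dotProduct_comm]

theorem det_vecMulVec_fin_two (u v : Fin 2 → ℂ) : (vecMulVec u v).det = 0 := by
  simp only [det_fin_two, vecMulVec_apply]
  ring

theorem im_trace_mul_eq_zero {n : Type*} [Fintype n] {H G : Matrix n n ℂ}
    (hH : H.IsHermitian) (hG : G.IsHermitian) : (H * G).trace.im = 0 := by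
  apply Complex.conj_eq_iff_im.1
  change star _ = _
  rw [← trace_conjTranspose, conjTranspose_mul, hH.eq, hG.eq, trace_mul_comm]

theorem im_det_eq_zero {n : Type*} [Fintype n] [DecidableEq n] {S : Matrix n n ℂ}
    (hS : S.IsHermitian) : S.det.im = 0 := by
  apply Complex.conj_eq_iff_im.1
  change star _ = _
  rw [← det_conjTranspose, hS.eq]

theorem im_apply_self_eq_zero {n : Type*} {S : Matrix n n ℂ}
    (hS : S.IsHermitian) (i : n) : (S i i).im = 0 :=
  Complex.conj_eq_iff_im.1 (hS.apply i i)

/-- A Hermitian `2 × 2` matrix of trace one and determinant zero is the orthogonal projection onto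
a line. -/
theorem exists_eq_vecMulVec_star {G : Matrix (Fin 2) (Fin 2) ℂ} (hG : G.IsHermitian)
    (ht : G.trace = 1) (hd : G.det = 0) : ∃ e : Fin 2 → ℂ, G = vecMulVec e (star e) := by
  have h00 : G 0 0 = ((G 0 0).re : ℂ) :=
    Complex.ext (by simp) (by simp [im_apply_self_eq_zero hG 0])
  have h10 : G 1 0 = star (G 0 1) := (hG.apply 1 0).symm
  rw [trace_fin_two] at ht
  have h11 : G 1 1 = 1 - G 0 0 := by linear_combination ht
  rw [det_fin_two, h11, h10] at hd
  have hd' : (G 0 0).re * (1 - (G 0 0).re) = Complex.normSq (G 0 1) := by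
    have h : G 0 1 * star (G 0 1) = (Complex.normSq (G 0 1) : ℂ) := Complex.mul_conj _
    rw [h, h00] at hd
    exact_mod_cast sub_eq_zero.1 hd
  generalize (G 0 0).re = p at *
  have hp : 0 ≤ p := by nlinarith [Complex.normSq_nonneg (G 0 1)]
  rcases hp.eq_or_lt with rfl | hp
  · have h01 : G 0 1 = 0 := by
      rw [← Complex.normSq_eq_zero, ← hd']; simp
    refine ⟨![0, 1], ?_⟩
    ext i j
    fin_cases i <;> fin_cases j <;> simp [vecMulVec_apply, h00, h10, h11, h01]
  · have hs : ((√p : ℝ) : ℂ) ≠ 0 := by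
      exact_mod_cast (Real.sqrt_pos.2 hp).ne'
    have hss : ((√p : ℝ) : ℂ) * (√p : ℝ) = p := by exact_mod_cast Real.mul_self_sqrt hp.le
    -- The first column of `G`, divided by the square root of its first entry.
    refine ⟨![(√p : ℝ), star (G 0 1) / (√p : ℝ)], ?_⟩
    ext i j
    fin_cases i <;> fin_cases j <;> simp [vecMulVec_apply, h00, h10, h11]
    · exact hss.symm
    · field_simp
    · field_simp
    · rw [div_mul_div_comm, hss, ← Complex.normSq_eq_conj_mul_self, ← hd']
      have : (p : ℂ) ≠ 0 := by exact_mod_cast hp.ne'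
      push_cast
      field_simp

/-- The traceless Hermitian `2 × 2` matrices have real dimension three, so the real-linear map
`K ↦ tr (A K)` into `ℂ` kills one of them; its determinant is negative. -/
theorem exists_traceless_hermitian (A : Matrix (Fin 2) (Fin 2) ℂ) :
    ∃ K : Matrix (Fin 2) (Fin 2) ℂ, K.IsHermitian ∧ K.trace = 0 ∧ (A * K).trace = 0 ∧
      K.det.re < 0 := by
  let f : (Fin 3 → ℝ) →ₗ[ℝ] ℂ :=
    { toFun := fun r => r 0 * (A 0 0 - A 1 1) + r 1 * (A 1 0 + A 0 1) +
        r 2 * (Complex.I * (A 0 1 - A 1 0))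
      map_add' := fun r s => by simp only [Pi.add_apply]; push_cast; ring
      map_smul' := fun c r => by
        simp only [Pi.smul_apply, smul_eq_mul, RingHom.id_apply, Complex.real_smul]
        push_cast; ring }
  have hker : LinearMap.ker f ≠ ⊥ :=
    f.ker_ne_bot_of_finrank_lt (by simp [Complex.finrank_real_complex])
  obtain ⟨r, hr, hr0⟩ := (Submodule.ne_bot_iff _).1 hker
  have hr' : (r 0 : ℂ) * (A 0 0 - A 1 1) + r 1 * (A 1 0 + A 0 1) +
      r 2 * (Complex.I * (A 0 1 - A 1 0)) = 0 := hr
  refine ⟨!![(r 0 : ℂ), r 1 - r 2 * Complex.I; r 1 + r 2 * Complex.I, -r 0], ?_, ?_, ?_, ?_⟩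
  · ext i j
    fin_cases i <;> fin_cases j <;> simp [Complex.ext_iff]
  · simp [trace_fin_two]
  · rw [← hr']
    simp [trace_fin_two, Matrix.mul_apply, Fin.sum_univ_two]
    ring
  · have h : r 0 ≠ 0 ∨ r 1 ≠ 0 ∨ r 2 ≠ 0 := by
      by_contra! h
      exact hr0 (by ext i; fin_cases i <;> simp [h])
    simp [det_fin_two]
    rcases h with h | h | h <;> have := mul_self_pos.2 h <;>
      nlinarith [mul_self_nonneg (r 0), mul_self_nonneg (r 1), mul_self_nonneg (r 2)]

/-- A density matrix can be moved to a rank-one projection without changing `tr (A G)`: along the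
line `G + s K`, with `K` traceless Hermitian and `tr (A K) = 0`, the determinant is a quadratic
polynomial in `s` which is nonnegative at `0` and has negative leading coefficient. -/
theorem exists_vecMulVec_trace_mul_eq (A : Matrix (Fin 2) (Fin 2) ℂ)
    {G : Matrix (Fin 2) (Fin 2) ℂ} (hG : G.PosSemidef) (ht : G.trace = 1) :
    ∃ e : Fin 2 → ℂ, star e ⬝ᵥ e = 1 ∧
      (A * vecMulVec e (star e)).trace = (A * G).trace := by
  obtain ⟨K, hK, hKt, hKA, hKd⟩ := exists_traceless_hermitian A
  have hGd : 0 ≤ G.det.re := (Complex.le_def.1 hG.det_nonneg).1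
  set b : ℂ := G 0 0 * K 1 1 + K 0 0 * G 1 1 - G 0 1 * K 1 0 - K 0 1 * G 1 0 with hb
  have hdet (s : ℝ) : (G + s • K).det = G.det + s * b + s ^ 2 * K.det := by
    simp [det_fin_two, hb]
    ring
  have hherm (s : ℝ) : (G + s • K).IsHermitian :=
    hG.1.add (hK.smul (IsSelfAdjoint.all s))
  obtain ⟨s, hs⟩ : ∃ s : ℝ, K.det.re * (s * s) + b.re * s + G.det.re = 0 := by
    refine exists_quadratic_eq_zero hKd.ne ⟨√(discrim K.det.re b.re G.det.re), ?_⟩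
    rw [Real.mul_self_sqrt]
    unfold discrim
    nlinarith [sq_nonneg b.re, mul_nonneg hGd (neg_nonneg.2 hKd.le)]
  have hs0 : (G + s • K).det = 0 := by
    apply Complex.ext
    · rw [hdet, ← Complex.ofReal_pow, Complex.add_re, Complex.add_re, Complex.re_ofReal_mul,
        Complex.re_ofReal_mul, Complex.zero_re]
      linear_combination hs
    · exact im_det_eq_zero (hherm s)
  have hst : (G + s • K).trace = 1 := by simp [trace_add, trace_smul, hKt, ht]
  obtain ⟨e, he⟩ := exists_eq_vecMulVec_star (hherm s) hst hs0
  refine ⟨e, ?_, ?_⟩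
  · rw [← trace_vecMulVec_star, ← he, hst]
  · rw [← he, mul_add, trace_add, mul_smul_comm, trace_smul, hKA, smul_zero, add_zero]

/-- The numerical range of a `2 × 2` matrix consists of the numbers `tr (A G)`, for `G` positive
semidefinite of trace one. -/
theorem mem_numericalRange_iff_exists_posSemidef (A : Matrix (Fin 2) (Fin 2) ℂ) (w : ℂ) :
    w ∈ numericalRange A ↔
      ∃ G : Matrix (Fin 2) (Fin 2) ℂ, G.PosSemidef ∧ G.trace = 1 ∧ (A * G).trace = w := by
  constructor
  · rintro ⟨e, he, hw⟩
    exact ⟨_, posSemidef_vecMulVec_self_star e, by rw [trace_vecMulVec_star, he],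
      by rw [trace_mul_vecMulVec_star, hw]⟩
  · rintro ⟨G, hG, ht, hw⟩
    obtain ⟨e, he, h⟩ := exists_vecMulVec_trace_mul_eq A hG ht
    exact ⟨e, he, by rw [← trace_mul_vecMulVec_star, h, hw]⟩

/-- The Toeplitz–Hausdorff theorem for `2 × 2` matrices. -/
theorem convex_numericalRange (A : Matrix (Fin 2) (Fin 2) ℂ) :
    Convex ℝ (numericalRange A) := by
  intro w₁ h₁ w₂ h₂ a b ha hb hab
  rw [mem_numericalRange_iff_exists_posSemidef] at h₁ h₂ ⊢
  obtain ⟨G₁, hG₁, ht₁, rfl⟩ := h₁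
  obtain ⟨G₂, hG₂, ht₂, rfl⟩ := h₂
  refine ⟨a • G₁ + b • G₂, (hG₁.smul ha).add (hG₂.smul hb), ?_, ?_⟩
  · rw [trace_add, trace_smul, trace_smul, ht₁, ht₂, ← add_smul, hab, one_smul]
  · rw [mul_add, trace_add, mul_smul_comm, mul_smul_comm, trace_smul, trace_smul]

theorem convex_upperNumericalRange (A : Matrix (Fin 2) (Fin 2) ℂ) :
    Convex ℝ (upperNumericalRange A) :=
  (convex_numericalRange A).inter (convex_halfSpace_im_ge 0)

/-! ### The upper bild and density matrices -/

open scoped MatrixOrder Matrix.Norms.L2Operator in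
theorem exists_mul_conjTranspose_eq {n : Type*} [Fintype n] [DecidableEq n] {G : Matrix n n ℂ}
    (hG : G.PosSemidef) : ∃ B : Matrix n n ℂ, B * Bᴴ = G := by
  obtain ⟨B, hB⟩ := CStarAlgebra.nonneg_iff_eq_star_mul_self.mp hG.nonneg
  exact ⟨Bᴴ, by rw [conjTranspose_conjTranspose, hB, star_eq_conjTranspose]⟩

theorem conjTranspose_mul_mul_apply {n : Type*} [Fintype n] (X M : Matrix n n ℂ) (i j : n) :
    (Xᴴ * M * X) i j = star (X.col i) ⬝ᵥ M.mulVec (X.col j) := by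
  rw [Matrix.mul_assoc]
  rfl

theorem trace_mul_mul_conjTranspose (X M : Matrix (Fin 2) (Fin 2) ℂ) :
    (M * (X * Xᴴ)).trace = (Xᴴ * M * X) 0 0 + (Xᴴ * M * X) 1 1 := by
  rw [← trace_fin_two, ← Matrix.mul_assoc, trace_mul_comm, Matrix.mul_assoc]

theorem trace_mul_conjTranspose_self (X : Matrix (Fin 2) (Fin 2) ℂ) :
    (X * Xᴴ).trace = star (X.col 0) ⬝ᵥ X.col 0 + star (X.col 1) ⬝ᵥ X.col 1 := by
  have h := trace_mul_mul_conjTranspose X 1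
  rwa [Matrix.one_mul, conjTranspose_mul_mul_apply, conjTranspose_mul_mul_apply, one_mulVec,
    one_mulVec] at h

theorem conjTranspose_add_I_smul {n : Type*} {H S : Matrix n n ℂ} (hH : H.IsHermitian)
    (hS : S.IsHermitian) : (H + Complex.I • S)ᴴ = H - Complex.I • S := by
  rw [conjTranspose_add, conjTranspose_smul, hH.eq, hS.eq]
  simp [sub_eq_add_neg]

/-- The bild of `H + i S`, with the two complex vectors `y`, `z` that make up a quaternionic vector
`y + z j` collected as the columns of a matrix `X`. -/
theorem mem_bild_iff_exists_matrix {H S : Matrix (Fin 2) (Fin 2) ℂ} (hH : H.IsHermitian)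
    (hS : S.IsHermitian) (w : ℂ) :
    w ∈ bild (toQuaternionMatrix (H + Complex.I • S)) ↔ ∃ X : Matrix (Fin 2) (Fin 2) ℂ,
      (X * Xᴴ).trace = 1 ∧ (Xᴴ * S * X) 0 1 = 0 ∧
        (H * (X * Xᴴ)).trace + Complex.I * ((Xᴴ * S * X) 0 0 - (Xᴴ * S * X) 1 1) = w := by
  have hsub : H + Complex.I • S - (H + Complex.I • S)ᴴ = (2 * Complex.I) • S := by
    rw [conjTranspose_add_I_smul hH hS, mul_smul, two_smul]
    abel
  have hI : (2 * Complex.I) ≠ 0 := by simp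
  rw [mem_bild_toQuaternionMatrix_iff, hsub, conjTranspose_add_I_smul hH hS]
  have key (X : Matrix (Fin 2) (Fin 2) ℂ) :
      (star (X.col 0) ⬝ᵥ X.col 0 + star (X.col 1) ⬝ᵥ X.col 1 = 1 ∧
        star (X.col 0) ⬝ᵥ ((2 * Complex.I) • S).mulVec (X.col 1) = 0 ∧
        star (X.col 0) ⬝ᵥ (H + Complex.I • S).mulVec (X.col 0) +
          star (X.col 1) ⬝ᵥ (H - Complex.I • S).mulVec (X.col 1) = w) ↔
      ((X * Xᴴ).trace = 1 ∧ (Xᴴ * S * X) 0 1 = 0 ∧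
        (H * (X * Xᴴ)).trace + Complex.I * ((Xᴴ * S * X) 0 0 - (Xᴴ * S * X) 1 1) = w) := by
    rw [trace_mul_conjTranspose_self, trace_mul_mul_conjTranspose]
    simp only [conjTranspose_mul_mul_apply, add_mulVec, sub_mulVec, smul_mulVec, dotProduct_add,
      dotProduct_sub, dotProduct_smul, smul_eq_mul, mul_eq_zero, hI, false_or]
    refine and_congr_right fun _ => and_congr_right fun _ => ?_
    ring_nf
  constructor
  · rintro ⟨y, z, h⟩
    exact ⟨(of ![y, z])ᵀ, (key (of ![y, z])ᵀ).1 h⟩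
  · rintro ⟨X, h⟩
    exact ⟨X.col 0, X.col 1, (key X).2 h⟩

/-- The discriminant of the characteristic polynomial of `Xᴴ S X`, expressed through `X Xᴴ` on the
one side and through the entries on the other. -/
theorem trace_sq_sub_four_mul_det (X S : Matrix (Fin 2) (Fin 2) ℂ) :
    (S * (X * Xᴴ)).trace ^ 2 - 4 * (S.det * (X * Xᴴ).det) =
      ((Xᴴ * S * X) 0 0 - (Xᴴ * S * X) 1 1) ^ 2 +
        4 * ((Xᴴ * S * X) 0 1 * (Xᴴ * S * X) 1 0) := by
  have h : S.det * (X * Xᴴ).det = (Xᴴ * S * X).det := by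
    rw [det_mul, det_mul, det_mul]; ring
  rw [h, trace_mul_mul_conjTranspose, det_fin_two]
  ring

/-- Any factorization `G = B Bᴴ` can be changed to `G = X Xᴴ` with `X = B U`, `U` unitary; a
`U` diagonalizing `Bᴴ S B` makes the columns of `X` orthogonal for `S`. -/
theorem exists_mul_conjTranspose_eq_and_apply_eq_zero {S G : Matrix (Fin 2) (Fin 2) ℂ}
    (hS : S.IsHermitian) (hG : G.PosSemidef) :
    ∃ X : Matrix (Fin 2) (Fin 2) ℂ, X * Xᴴ = G ∧ (Xᴴ * S * X) 0 1 = 0 ∧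
      ((Xᴴ * S * X) 1 1).re ≤ ((Xᴴ * S * X) 0 0).re := by
  obtain ⟨B, rfl⟩ := exists_mul_conjTranspose_eq hG
  have hM : (Bᴴ * S * B).IsHermitian := isHermitian_conjTranspose_mul_mul B hS
  set U : Matrix (Fin 2) (Fin 2) ℂ := (hM.eigenvectorUnitary : Matrix (Fin 2) (Fin 2) ℂ)
  have hUU : U * Uᴴ = 1 := Unitary.coe_mul_star_self hM.eigenvectorUnitary
  have hdiag : (B * U)ᴴ * S * (B * U) = diagonal (RCLike.ofReal ∘ hM.eigenvalues) := by
    have h := hM.spectral_theorem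
    have hUU' : Uᴴ * U = 1 := Unitary.coe_star_mul_self hM.eigenvectorUnitary
    rw [Unitary.conjStarAlgAut_apply] at h
    calc (B * U)ᴴ * S * (B * U) = Uᴴ * (Bᴴ * S * B) * U := by
          simp only [conjTranspose_mul, Matrix.mul_assoc]
      _ = Uᴴ * (U * diagonal (RCLike.ofReal ∘ hM.eigenvalues) * Uᴴ) * U := by
          conv_lhs => rw [h]
          rfl
      _ = (Uᴴ * U) * diagonal (RCLike.ofReal ∘ hM.eigenvalues) * (Uᴴ * U) := by
          simp only [Matrix.mul_assoc]
      _ = _ := by rw [hUU', Matrix.one_mul, Matrix.mul_one]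
  have hBU : (B * U) * (B * U)ᴴ = B * Bᴴ := by
    rw [conjTranspose_mul, Matrix.mul_assoc, ← Matrix.mul_assoc U, hUU, Matrix.one_mul]
  rcases le_total (hM.eigenvalues 1) (hM.eigenvalues 0) with hle | hle
  · exact ⟨B * U, hBU, by rw [hdiag]; simp, by rw [hdiag]; simpa using hle⟩
  -- Exchange the two columns if the eigenvalues come in the wrong order.
  · set P : Matrix (Fin 2) (Fin 2) ℂ := !![0, 1; 1, 0] with hP
    have hPs : Pᴴ = P := by
      ext i j
      fin_cases i <;> fin_cases j <;> simp [hP]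
    have hPP : P * Pᴴ = 1 := by
      rw [hPs, hP, one_fin_two]
      simp
    have hdiag' : (B * U * P)ᴴ * S * (B * U * P) =
        P * diagonal (RCLike.ofReal ∘ hM.eigenvalues) * P := by
      rw [← hdiag]
      simp only [conjTranspose_mul, Matrix.mul_assoc, hPs]
    refine ⟨B * U * P, ?_, ?_, ?_⟩
    · rw [conjTranspose_mul, Matrix.mul_assoc, ← Matrix.mul_assoc P, hPP, Matrix.one_mul, hBU]
    · rw [hdiag']
      simp [hP, Matrix.mul_apply, Fin.sum_univ_two, vecMul_diagonal]
    · rw [hdiag']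
      simpa [hP, Matrix.mul_apply, Fin.sum_univ_two, vecMul_diagonal] using hle

/-- Description of the upper bild by density matrices `G`: the real part is `tr (H G)`, and the
square of the imaginary part is the discriminant `tr (S G) ^ 2 - 4 det S det G`, the squared
difference of the eigenvalues of `S G`. -/
theorem mem_upperBild_iff_exists_posSemidef {H S : Matrix (Fin 2) (Fin 2) ℂ}
    (hH : H.IsHermitian) (hS : S.IsHermitian) (w : ℂ) :
    w ∈ upperBild (toQuaternionMatrix (H + Complex.I • S)) ↔
      0 ≤ w.im ∧ ∃ G : Matrix (Fin 2) (Fin 2) ℂ, G.PosSemidef ∧ G.trace = 1 ∧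
        (H * G).trace.re = w.re ∧
          w.im ^ 2 = (S * G).trace.re ^ 2 - 4 * (S.det.re * G.det.re) := by
  rw [upperBild, Set.mem_inter_iff, and_comm]
  refine and_congr_right fun hw => ?_
  replace hw : 0 ≤ w.im := hw
  rw [mem_bild_iff_exists_matrix hH hS]
  have hreal (X : Matrix (Fin 2) (Fin 2) ℂ) (i : Fin 2) :
      (Xᴴ * S * X) i i = (((Xᴴ * S * X) i i).re : ℂ) :=
    Complex.ext (by simp)
      (by simp [im_apply_self_eq_zero (isHermitian_conjTranspose_mul_mul X hS) i])
  have htr {H G : Matrix (Fin 2) (Fin 2) ℂ} (hH : H.IsHermitian) (hG : G.PosSemidef) :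
      (H * G).trace = ((H * G).trace.re : ℂ) :=
    Complex.ext (by simp) (by simp [im_trace_mul_eq_zero hH hG.1])
  have hdet {G : Matrix (Fin 2) (Fin 2) ℂ} (hG : G.IsHermitian) : G.det = (G.det.re : ℂ) :=
    Complex.ext (by simp) (by simp [im_det_eq_zero hG])
  have hcast {G : Matrix (Fin 2) (Fin 2) ℂ} (hG : G.PosSemidef) :
      (((S * G).trace.re ^ 2 - 4 * (S.det.re * G.det.re) : ℝ) : ℂ) =
        (S * G).trace ^ 2 - 4 * (S.det * G.det) := by
    rw [htr hS hG, hdet hS, hdet hG.1]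
    simp
  constructor
  · rintro ⟨X, ht, h01, rfl⟩
    have hpos := posSemidef_self_mul_conjTranspose X
    refine ⟨X * Xᴴ, hpos, ht, ?_, ?_⟩
    · rw [hreal X 0, hreal X 1]
      simp
    · apply Complex.ofReal_injective
      rw [hcast hpos, trace_sq_sub_four_mul_det, h01, htr hH hpos, hreal X 0, hreal X 1]
      simp
  · rintro ⟨G, hG, ht, hre, him⟩
    replace him := congrArg Complex.ofReal him
    rw [hcast hG] at him
    obtain ⟨X, rfl, h01, hle⟩ := exists_mul_conjTranspose_eq_and_apply_eq_zero hS hG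
    refine ⟨X, ht, h01, ?_⟩
    rw [trace_sq_sub_four_mul_det, h01, hreal X 0, hreal X 1, zero_mul, mul_zero, add_zero] at him
    have him' : w.im = ((Xᴴ * S * X) 0 0).re - ((Xᴴ * S * X) 1 1).re := by
      rw [← abs_of_nonneg hw, ← abs_of_nonneg (sub_nonneg.2 hle), ← sq_eq_sq_iff_abs_eq_abs]
      exact_mod_cast him
    rw [htr hH hG, hre, hreal X 0, hreal X 1, ← Complex.ofReal_sub, ← him', mul_comm]
    exact Complex.re_add_im w

/-! ### Quadratic forms of `H ± i S` -/

theorem trace_add_I_smul_mul {n : Type*} [Fintype n] (H S G : Matrix n n ℂ) :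
    ((H + Complex.I • S) * G).trace = (H * G).trace + Complex.I * (S * G).trace := by
  rw [add_mul, trace_add, smul_mul_assoc, trace_smul, smul_eq_mul]

theorem dotProduct_add_I_smul_mulVec {n : Type*} [Fintype n] (H S : Matrix n n ℂ) (y : n → ℂ) :
    star y ⬝ᵥ (H + Complex.I • S).mulVec y =
      star y ⬝ᵥ H.mulVec y + Complex.I * (star y ⬝ᵥ S.mulVec y) := by
  rw [add_mulVec, smul_mulVec, dotProduct_add, dotProduct_smul, smul_eq_mul]

theorem dotProduct_sub_I_smul_mulVec {n : Type*} [Fintype n] (H S : Matrix n n ℂ) (y : n → ℂ) :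
    star y ⬝ᵥ (H - Complex.I • S).mulVec y =
      star y ⬝ᵥ H.mulVec y - Complex.I * (star y ⬝ᵥ S.mulVec y) := by
  rw [sub_mulVec, smul_mulVec, dotProduct_sub, dotProduct_smul, smul_eq_mul]

theorem im_dotProduct_mulVec_eq_zero {n : Type*} [Fintype n] {S : Matrix n n ℂ}
    (hS : S.IsHermitian) (y : n → ℂ) : (star y ⬝ᵥ S.mulVec y).im = 0 := by
  rw [← trace_mul_vecMulVec_star]
  exact im_trace_mul_eq_zero hS (posSemidef_vecMulVec_self_star y).1

theorem re_dotProduct_add_I_smul_mulVec {n : Type*} [Fintype n] (H : Matrix n n ℂ)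
    {S : Matrix n n ℂ} (hS : S.IsHermitian) (y : n → ℂ) :
    (star y ⬝ᵥ (H + Complex.I • S).mulVec y).re = (star y ⬝ᵥ H.mulVec y).re := by
  rw [dotProduct_add_I_smul_mulVec, Complex.add_re, Complex.I_mul_re,
    im_dotProduct_mulVec_eq_zero hS, neg_zero, add_zero]

theorem im_dotProduct_add_I_smul_mulVec {n : Type*} [Fintype n] {H : Matrix n n ℂ}
    (hH : H.IsHermitian) (S : Matrix n n ℂ) (y : n → ℂ) :
    (star y ⬝ᵥ (H + Complex.I • S).mulVec y).im = (star y ⬝ᵥ S.mulVec y).re := by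
  rw [dotProduct_add_I_smul_mulVec, Complex.add_im, Complex.I_mul_im,
    im_dotProduct_mulVec_eq_zero hH, zero_add]

theorem re_dotProduct_sub_I_smul_mulVec {n : Type*} [Fintype n] (H : Matrix n n ℂ)
    {S : Matrix n n ℂ} (hS : S.IsHermitian) (y : n → ℂ) :
    (star y ⬝ᵥ (H - Complex.I • S).mulVec y).re = (star y ⬝ᵥ H.mulVec y).re := by
  rw [dotProduct_sub_I_smul_mulVec, Complex.sub_re, Complex.I_mul_re,
    im_dotProduct_mulVec_eq_zero hS, neg_zero, sub_zero]

theorem im_dotProduct_sub_I_smul_mulVec {n : Type*} [Fintype n] {H : Matrix n n ℂ}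
    (hH : H.IsHermitian) (S : Matrix n n ℂ) (y : n → ℂ) :
    (star y ⬝ᵥ (H - Complex.I • S).mulVec y).im = -(star y ⬝ᵥ S.mulVec y).re := by
  rw [dotProduct_sub_I_smul_mulVec, Complex.sub_im, Complex.I_mul_im,
    im_dotProduct_mulVec_eq_zero hH, zero_sub]

theorem dotProduct_star_self_eq_ofReal {n : Type*} [Fintype n] (y : n → ℂ) :
    star y ⬝ᵥ y = ((star y ⬝ᵥ y).re : ℂ) := by
  classical
  have h := im_dotProduct_mulVec_eq_zero (isHermitian_one (n := n) (α := ℂ)) y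
  rw [one_mulVec] at h
  exact Complex.ext (by simp) (by simp [h])

theorem re_dotProduct_star_self_nonneg {n : Type*} [Fintype n] (y : n → ℂ) :
    0 ≤ (star y ⬝ᵥ y).re :=
  (Complex.le_def.1 (dotProduct_star_self_nonneg y)).1

theorem exists_mem_numericalRange_smul (A : Matrix (Fin 2) (Fin 2) ℂ) {y : Fin 2 → ℂ}
    (hy : y ≠ 0) :
    ∃ p ∈ numericalRange A, star y ⬝ᵥ A.mulVec y = (star y ⬝ᵥ y).re • p := by
  have hn0 := dotProduct_star_self_eq_ofReal y
  have hn := re_dotProduct_star_self_nonneg y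
  have hne : (star y ⬝ᵥ y).re ≠ 0 := fun h => hy <| by
    rwa [h, Complex.ofReal_zero, dotProduct_star_self_eq_zero] at hn0
  generalize (star y ⬝ᵥ y).re = n at *
  refine ⟨(A * n⁻¹ • vecMulVec y (star y)).trace,
    (mem_numericalRange_iff_exists_posSemidef A _).2 ⟨_,
      (posSemidef_vecMulVec_self_star y).smul (inv_nonneg.2 hn), ?_, rfl⟩, ?_⟩
  · rw [trace_smul, trace_vecMulVec_star, hn0, Complex.real_smul, ← Complex.ofReal_mul,
      inv_mul_cancel₀ hne, Complex.ofReal_one]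
  · rw [mul_smul_comm, trace_smul, trace_mul_vecMulVec_star, smul_smul, mul_inv_cancel₀ hne,
      one_smul]

/-- The case `y = 0` is the reason for the nonemptiness hypothesis. -/
theorem exists_mem_upperNumericalRange_smul {A : Matrix (Fin 2) (Fin 2) ℂ}
    (hne : (upperNumericalRange A).Nonempty) {y : Fin 2 → ℂ}
    (hy : 0 ≤ (star y ⬝ᵥ A.mulVec y).im) :
    ∃ p ∈ upperNumericalRange A, star y ⬝ᵥ A.mulVec y = (star y ⬝ᵥ y).re • p := by
  rcases eq_or_ne y 0 with rfl | hy0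
  · obtain ⟨p, hp⟩ := hne
    exact ⟨p, hp, by simp⟩
  · obtain ⟨p, hp, h⟩ := exists_mem_numericalRange_smul A hy0
    refine ⟨p, ⟨hp, ?_⟩, h⟩
    have hn : 0 < (star y ⬝ᵥ y).re := by
      refine (re_dotProduct_star_self_nonneg y).lt_of_ne fun h0 => hy0 ?_
      have := dotProduct_star_self_eq_ofReal y
      rwa [← h0, Complex.ofReal_zero, dotProduct_star_self_eq_zero] at this
    rw [h, Complex.smul_im, smul_eq_mul] at hy
    exact nonneg_of_mul_nonneg_right hy hn

/-! ### The singular semidefinite case -/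

/-- Rank-one density matrices have determinant zero and thus discriminant `tr (S G) ^ 2`. -/
theorem upperNumericalRange_subset_upperBild {H S : Matrix (Fin 2) (Fin 2) ℂ}
    (hH : H.IsHermitian) (hS : S.IsHermitian) :
    upperNumericalRange (H + Complex.I • S) ⊆
      upperBild (toQuaternionMatrix (H + Complex.I • S)) := by
  rintro w ⟨⟨e, he, rfl⟩, hw⟩
  rw [mem_upperBild_iff_exists_posSemidef hH hS]
  refine ⟨hw, _, posSemidef_vecMulVec_self_star e, by rw [trace_vecMulVec_star, he], ?_, ?_⟩
  · rw [trace_mul_vecMulVec_star, re_dotProduct_add_I_smul_mulVec H hS]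
  · rw [trace_mul_vecMulVec_star, det_vecMulVec_fin_two, im_dotProduct_add_I_smul_mulVec hH,
      Complex.zero_re, mul_zero, mul_zero, sub_zero]

/-- Since `det S = 0`, the discriminant is `tr (S G) ^ 2`, and the points of the upper bild are
the numbers `tr (A G)`. -/
theorem upperBild_eq_of_posSemidef_of_not_posDef {H S : Matrix (Fin 2) (Fin 2) ℂ}
    (hH : H.IsHermitian) (hS : S.PosSemidef) (hS' : ¬ S.PosDef) :
    upperBild (toQuaternionMatrix (H + Complex.I • S)) =
      upperNumericalRange (H + Complex.I • S) := by
  refine Set.Subset.antisymm (fun w hw => ?_) (upperNumericalRange_subset_upperBild hH hS.1)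
  have hd : S.det = 0 := by
    rwa [hS.posDef_iff_det_ne_zero, not_not] at hS'
  rw [mem_upperBild_iff_exists_posSemidef hH hS.1] at hw
  obtain ⟨hw, G, hG, ht, hre, him⟩ := hw
  refine ⟨(mem_numericalRange_iff_exists_posSemidef _ _).2 ⟨G, hG, ht, ?_⟩, hw⟩
  have hSG : 0 ≤ (S * G).trace.re := by
    obtain ⟨X, rfl⟩ := exists_mul_conjTranspose_eq hG
    rw [← Matrix.mul_assoc, trace_mul_comm, ← Matrix.mul_assoc]
    exact (Complex.le_def.1 (hS.conjTranspose_mul_mul_same X).trace_nonneg).1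
  rw [hd, Complex.zero_re, zero_mul, mul_zero, sub_zero, sq_eq_sq₀ hw hSG] at him
  rw [trace_add_I_smul_mul]
  apply Complex.ext
  · simp [hre, im_trace_mul_eq_zero hS.1 hG.1]
  · simp [him, im_trace_mul_eq_zero hH hG.1]

/-! ### The indefinite case -/

theorem det_mul_det_add_vecMulVec_star (S : Matrix (Fin 2) (Fin 2) ℂ) (e f : Fin 2 → ℂ)
    (a b : ℝ) :
    S.det * (a • vecMulVec e (star e) + b • vecMulVec f (star f)).det =
      a * b * ((star e ⬝ᵥ S.mulVec e) * (star f ⬝ᵥ S.mulVec f) -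
        (star e ⬝ᵥ S.mulVec f) * (star f ⬝ᵥ S.mulVec e)) := by
  simp only [det_fin_two, Matrix.add_apply, Matrix.smul_apply, vecMulVec_apply, dotProduct, mulVec,
    Fin.sum_univ_two, Pi.star_apply, Complex.real_smul]
  ring

theorem re_det_mul_re_det_add_vecMulVec_star {S : Matrix (Fin 2) (Fin 2) ℂ}
    (hS : S.IsHermitian) (e f : Fin 2 → ℂ) (a b : ℝ) :
    S.det.re * (a • vecMulVec e (star e) + b • vecMulVec f (star f)).det.re =
      a * b * ((star e ⬝ᵥ S.mulVec e).re * (star f ⬝ᵥ S.mulVec f).re -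
        Complex.normSq (star e ⬝ᵥ S.mulVec f)) := by
  have h := congrArg Complex.re (det_mul_det_add_vecMulVec_star S e f a b)
  have hfe : star f ⬝ᵥ S.mulVec e = (starRingEnd ℂ) (star e ⬝ᵥ S.mulVec f) := by
    change _ = star _
    rw [← star_dotProduct, star_mulVec, hS.eq, dotProduct_mulVec]
  rw [hfe, Complex.mul_conj, Complex.mul_re, im_det_eq_zero hS, zero_mul, sub_zero] at h
  rw [h, ← Complex.ofReal_mul, Complex.re_ofReal_mul, Complex.sub_re, Complex.mul_re,
    im_dotProduct_mulVec_eq_zero hS, zero_mul, sub_zero, Complex.ofReal_re]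

theorem IsIndefinite.re_det_neg {S : Matrix (Fin 2) (Fin 2) ℂ} (hS : IsIndefinite S) :
    S.det.re < 0 := by
  obtain ⟨hS, ⟨x, -, hx⟩, y, -, hy⟩ := hS
  have h := re_det_mul_re_det_add_vecMulVec_star hS x y 1 1
  have hpos : 0 ≤ ((1 : ℝ) • vecMulVec x (star x) + (1 : ℝ) • vecMulVec y (star y)).det.re :=
    (Complex.le_def.1 (((posSemidef_vecMulVec_self_star x).smul zero_le_one).add
      ((posSemidef_vecMulVec_self_star y).smul zero_le_one)).det_nonneg).1
  by_contra! hd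
  have := mul_nonneg hd hpos
  nlinarith [mul_neg_of_pos_of_neg hx hy, Complex.normSq_nonneg (star x ⬝ᵥ S.mulVec y)]

/-- If `y`, `z` are orthogonal for `S`, the numbers `y* S y` and `z* S z` cannot have the same sign,
as their product is `det S` times a nonnegative number. So the point is a convex combination of a
point coming from `y` and one coming from `z`. -/
theorem upperBild_subset_of_isIndefinite {H S : Matrix (Fin 2) (Fin 2) ℂ} (hH : H.IsHermitian)
    (hS : IsIndefinite S) :
    upperBild (toQuaternionMatrix (H + Complex.I • S)) ⊆
      convexHull ℝ (upperNumericalRange (H + Complex.I • S) ∪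
        upperNumericalRange (H + Complex.I • S)ᴴ) := by
  rintro w ⟨hw, him⟩
  have hd := hS.re_det_neg
  obtain ⟨hSH, ⟨x₁, hx₁, hpos⟩, x₂, hx₂, hneg⟩ := hS
  rw [conjTranspose_add_I_smul hH hSH]
  obtain ⟨X, ht, h01, rfl⟩ := (mem_bild_iff_exists_matrix hH hSH w).1 hw
  have hherm := isHermitian_conjTranspose_mul_mul X hSH
  have hle : ((Xᴴ * S * X) 1 1).re ≤ ((Xᴴ * S * X) 0 0).re := by
    have h : 0 ≤ ((H * (X * Xᴴ)).trace +
      Complex.I * ((Xᴴ * S * X) 0 0 - (Xᴴ * S * X) 1 1)).im := him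
    rw [Complex.add_im,
      im_trace_mul_eq_zero hH (posSemidef_self_mul_conjTranspose X).1] at h
    simpa using h
  have hdet : ((Xᴴ * S * X) 0 0).re * ((Xᴴ * S * X) 1 1).re ≤ 0 := by
    have h1 : (Xᴴ * S * X).det = S.det * (X * Xᴴ).det := by
      rw [det_mul, det_mul, det_mul]; ring
    have h2 := congrArg Complex.re h1
    rw [det_fin_two, h01, zero_mul, sub_zero, Complex.mul_re, Complex.mul_re,
      im_apply_self_eq_zero hherm, im_det_eq_zero hSH, zero_mul, zero_mul, sub_zero,
      sub_zero] at h2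
    rw [h2]
    exact mul_nonpos_of_nonpos_of_nonneg hd.le
      (Complex.le_def.1 (posSemidef_self_mul_conjTranspose X).det_nonneg).1
  -- As `Im w ≥ 0` is the difference of the diagonal entries, whose product is nonpositive, the
  -- first is `≥ 0` and the second is `≤ 0`.
  have h00 : 0 ≤ ((Xᴴ * S * X) 0 0).re := by
    by_contra! h
    nlinarith [mul_pos_of_neg_of_neg h (hle.trans_lt h)]
  have h11 : ((Xᴴ * S * X) 1 1).re ≤ 0 := by
    by_contra! h
    nlinarith [mul_pos (h.trans_le hle) h]
  rw [conjTranspose_mul_mul_apply] at h00 h11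
  rw [trace_mul_conjTranspose_self, dotProduct_star_self_eq_ofReal (X.col 0),
    dotProduct_star_self_eq_ofReal (X.col 1)] at ht
  obtain ⟨p, hp, hpe⟩ := exists_mem_upperNumericalRange_smul (A := H + Complex.I • S)
    (y := X.col 0)
    ⟨_, ⟨x₁, hx₁, rfl⟩, by
      change 0 ≤ Complex.im _
      rw [im_dotProduct_add_I_smul_mulVec hH]
      exact hpos.le⟩
    (by
      rw [im_dotProduct_add_I_smul_mulVec hH]
      exact h00)
  obtain ⟨q, hq, hqe⟩ := exists_mem_upperNumericalRange_smul (A := H - Complex.I • S)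
    (y := X.col 1)
    ⟨_, ⟨x₂, hx₂, rfl⟩, by
      change 0 ≤ Complex.im _
      rw [im_dotProduct_sub_I_smul_mulVec hH]
      exact neg_nonneg.2 hneg.le⟩
    (by
      rw [im_dotProduct_sub_I_smul_mulVec hH]
      exact neg_nonneg.2 h11)
  have hsum := convex_convexHull ℝ (upperNumericalRange (H + Complex.I • S) ∪
      upperNumericalRange (H - Complex.I • S))
    (subset_convexHull ℝ _ (Or.inl hp)) (subset_convexHull ℝ _ (Or.inr hq))
    (re_dotProduct_star_self_nonneg (X.col 0)) (re_dotProduct_star_self_nonneg (X.col 1))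
    (by exact_mod_cast ht)
  rw [← hpe, ← hqe, dotProduct_add_I_smul_mulVec, dotProduct_sub_I_smul_mulVec] at hsum
  convert hsum using 1
  rw [trace_mul_mul_conjTranspose]
  simp only [conjTranspose_mul_mul_apply]
  ring

/-- A convex combination of points given by `e` and `f` has the real part belonging to the density
matrix `G₁ = a e e* + b f f*`, whose discriminant is too large. A rank-one `G₀` with the same
`tr (H G)` and `tr (S G)` has a discriminant which is too small. The intermediate value theorem on
the segment from `G₀` to `G₁` gives the required density matrix. -/
theorem subset_upperBild_of_isIndefinite {H S : Matrix (Fin 2) (Fin 2) ℂ} (hH : H.IsHermitian)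
    (hS : IsIndefinite S) :
    convexHull ℝ (upperNumericalRange (H + Complex.I • S) ∪
        upperNumericalRange (H + Complex.I • S)ᴴ) ⊆
      upperBild (toQuaternionMatrix (H + Complex.I • S)) := by
  obtain ⟨hSH, ⟨x₁, hx₁, hpos⟩, x₂, hx₂, hneg⟩ := hS
  rw [conjTranspose_add_I_smul hH hSH, (convex_upperNumericalRange _).convexHull_union
    (convex_upperNumericalRange _)
    ⟨_, ⟨x₁, hx₁, rfl⟩, by
      change 0 ≤ Complex.im _
      rw [im_dotProduct_add_I_smul_mulVec hH]
      exact hpos.le⟩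
    ⟨_, ⟨x₂, hx₂, rfl⟩, by
      change 0 ≤ Complex.im _
      rw [im_dotProduct_sub_I_smul_mulVec hH]
      exact neg_nonneg.2 hneg.le⟩]
  intro w hw
  obtain ⟨p, ⟨⟨e, he, rfl⟩, hp⟩, q, ⟨⟨f, hf, rfl⟩, hq⟩, a, b, ha, hb, hab, rfl⟩ :=
    mem_convexJoin.1 hw
  replace hp : 0 ≤ (star e ⬝ᵥ S.mulVec e).re := by
    change 0 ≤ Complex.im _ at hp
    rwa [im_dotProduct_add_I_smul_mulVec hH] at hp
  replace hq : (star f ⬝ᵥ S.mulVec f).re ≤ 0 := by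
    change 0 ≤ Complex.im _ at hq
    rw [im_dotProduct_sub_I_smul_mulVec hH] at hq
    exact neg_nonneg.1 hq
  rw [mem_upperBild_iff_exists_posSemidef hH hSH]
  set α := (star e ⬝ᵥ S.mulVec e).re with hα
  set β := (star f ⬝ᵥ S.mulVec f).re with hβ
  have him : (a • (star e ⬝ᵥ (H + Complex.I • S).mulVec e) +
      b • (star f ⬝ᵥ (H - Complex.I • S).mulVec f)).im = a * α - b * β := by
    rw [Complex.add_im, Complex.smul_im, Complex.smul_im, im_dotProduct_add_I_smul_mulVec hH,
      im_dotProduct_sub_I_smul_mulVec hH, smul_eq_mul, smul_eq_mul, mul_neg, sub_eq_add_neg]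
  have hre : (a • (star e ⬝ᵥ (H + Complex.I • S).mulVec e) +
      b • (star f ⬝ᵥ (H - Complex.I • S).mulVec f)).re =
      a * (star e ⬝ᵥ H.mulVec e).re + b * (star f ⬝ᵥ H.mulVec f).re := by
    rw [Complex.add_re, Complex.smul_re, Complex.smul_re, re_dotProduct_add_I_smul_mulVec H hSH,
      re_dotProduct_sub_I_smul_mulVec H hSH, smul_eq_mul, smul_eq_mul]
  rw [him, hre]
  set G₁ := a • vecMulVec e (star e) + b • vecMulVec f (star f) with hG₁
  have hG₁pos : G₁.PosSemidef := ((posSemidef_vecMulVec_self_star e).smul ha).add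
    ((posSemidef_vecMulVec_self_star f).smul hb)
  have htr (M : Matrix (Fin 2) (Fin 2) ℂ) : (M * G₁).trace =
      a • (star e ⬝ᵥ M.mulVec e) + b • (star f ⬝ᵥ M.mulVec f) := by
    rw [hG₁, mul_add, trace_add, mul_smul_comm, mul_smul_comm, trace_smul, trace_smul,
      trace_mul_vecMulVec_star, trace_mul_vecMulVec_star]
  have hG₁tr : G₁.trace = 1 := by
    have h := htr 1
    rwa [Matrix.one_mul, one_mulVec, one_mulVec, he, hf, ← add_smul, hab, one_smul] at h
  obtain ⟨g, hg, hgA⟩ := exists_vecMulVec_trace_mul_eq (H + Complex.I • S) hG₁pos hG₁tr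
  have hG₀pos := posSemidef_vecMulVec_self_star g
  have hG₀tr := (trace_vecMulVec_star g).trans hg
  have hG₀det : (vecMulVec g (star g)).det = 0 := det_vecMulVec_fin_two _ _
  set G₀ := vecMulVec g (star g)
  rw [trace_add_I_smul_mul, trace_add_I_smul_mul, Complex.ext_iff] at hgA
  have hHG : (H * G₀).trace.re = (H * G₁).trace.re := by
    simpa [im_trace_mul_eq_zero hSH hG₀pos.1, im_trace_mul_eq_zero hSH hG₁pos.1]
      using hgA.1
  have hSG : (S * G₀).trace.re = (S * G₁).trace.re := by
    simpa [im_trace_mul_eq_zero hH hG₀pos.1, im_trace_mul_eq_zero hH hG₁pos.1]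
      using hgA.2
  have hline (M : Matrix (Fin 2) (Fin 2) ℂ) (h : (M * G₀).trace.re = (M * G₁).trace.re) (s : ℝ) :
      (M * ((1 - s) • G₀ + s • G₁)).trace.re = (M * G₁).trace.re := by
    rw [mul_add, trace_add, mul_smul_comm, mul_smul_comm, trace_smul, trace_smul,
      Complex.add_re, Complex.smul_re, Complex.smul_re, h, ← add_smul, sub_add_cancel, one_smul]
  have hST : (S * G₁).trace.re = a * α + b * β := by
    rw [htr, Complex.add_re, Complex.smul_re, Complex.smul_re, smul_eq_mul, smul_eq_mul]
  have hcont : Continuous fun s : ℝ =>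
      (S * G₁).trace.re ^ 2 - 4 * (S.det.re * ((1 - s) • G₀ + s • G₁).det.re) := by
    have : Continuous fun s : ℝ => ((1 - s) • G₀ + s • G₁).det :=
      Continuous.matrix_det (by fun_prop)
    have h2 : Continuous fun s : ℝ => ((1 - s) • G₀ + s • G₁).det.re :=
      Complex.continuous_re.comp this
    fun_prop
  -- At `s = 0` the discriminant is `(a α + b β) ^ 2`, at `s = 1` it exceeds `(a α - b β) ^ 2` by
  -- `4 a b |e* S f| ^ 2`; the signs `α ≥ 0 ≥ β` put `(a α - b β) ^ 2` in between.
  have hmem : (a * α - b * β) ^ 2 ∈ Set.Icc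
      ((S * G₁).trace.re ^ 2 - 4 * (S.det.re * ((1 - (0 : ℝ)) • G₀ + (0 : ℝ) • G₁).det.re))
      ((S * G₁).trace.re ^ 2 - 4 * (S.det.re * ((1 - (1 : ℝ)) • G₀ + (1 : ℝ) • G₁).det.re)) := by
    have hneg : a * b * (α * β) ≤ 0 :=
      mul_nonpos_of_nonneg_of_nonpos (mul_nonneg ha hb) (mul_nonpos_of_nonneg_of_nonpos hp hq)
    constructor
    · rw [sub_zero, one_smul, zero_smul, add_zero, hG₀det, hST, Complex.zero_re]
      linarith
    · rw [sub_self, one_smul, zero_smul, zero_add, hST, hG₁,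
        re_det_mul_re_det_add_vecMulVec_star hSH, ← hα, ← hβ]
      linarith [mul_nonneg (mul_nonneg ha hb) (Complex.normSq_nonneg (star e ⬝ᵥ S.mulVec f))]
  obtain ⟨s, ⟨hs0, hs1⟩, hs⟩ := intermediate_value_Icc zero_le_one hcont.continuousOn hmem
  refine ⟨?_, (1 - s) • G₀ + s • G₁,
    (hG₀pos.smul (sub_nonneg.2 hs1)).add (hG₁pos.smul hs0), ?_, ?_, ?_⟩
  · linarith [mul_nonneg ha hp, mul_nonpos_of_nonneg_of_nonpos hb hq]
  · rw [trace_add, trace_smul, trace_smul, hG₀tr, hG₁tr, ← add_smul, sub_add_cancel, one_smul]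
  · rw [hline H hHG, htr, Complex.add_re, Complex.smul_re, Complex.smul_re, smul_eq_mul,
      smul_eq_mul]
  · rw [hline S hSG]
    exact hs.symm

/-! ### The definite case -/

theorem mul_adjugate_conjTranspose_mul_mul {n : Type*} [Fintype n] [DecidableEq n]
    (X S : Matrix n n ℂ) :
    X * (Xᴴ * S * X).adjugate * Xᴴ = (X * Xᴴ).det • S.adjugate := by
  calc X * (Xᴴ * S * X).adjugate * Xᴴ
      = (X * X.adjugate) * S.adjugate * (Xᴴ.adjugate * Xᴴ) := by
        simp only [adjugate_mul_distrib, Matrix.mul_assoc]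
    _ = (X * Xᴴ).det • S.adjugate := by
        rw [mul_adjugate, adjugate_mul, det_mul, smul_mul_assoc, Matrix.one_mul, mul_smul_comm,
          Matrix.mul_one, smul_smul, mul_comm]

/-- If the columns `y`, `z` of `X` are orthogonal for `S`, then
`(z* S z) y y* + (y* S y) z z* = det (X Xᴴ) adj S`;
this is the trace of that identity against `M`. -/
theorem det_mul_trace_mul_adjugate {X S : Matrix (Fin 2) (Fin 2) ℂ} (hS : S.IsHermitian)
    (h01 : (Xᴴ * S * X) 0 1 = 0) (M : Matrix (Fin 2) (Fin 2) ℂ) :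
    (X * Xᴴ).det * (M * S.adjugate).trace =
      (Xᴴ * M * X) 0 0 * (Xᴴ * S * X) 1 1 + (Xᴴ * M * X) 1 1 * (Xᴴ * S * X) 0 0 := by
  have h10 : (Xᴴ * S * X) 1 0 = 0 := by
    rw [← (isHermitian_conjTranspose_mul_mul X hS).apply, h01, star_zero]
  rw [← smul_eq_mul, ← trace_smul, ← mul_smul_comm, ← mul_adjugate_conjTranspose_mul_mul,
    ← Matrix.mul_assoc, trace_mul_comm, ← Matrix.mul_assoc, ← Matrix.mul_assoc, trace_fin_two,
    adjugate_fin_two]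
  generalize Xᴴ * S * X = K at *
  generalize Xᴴ * M * X = N
  simp [Matrix.mul_apply, Fin.sum_univ_two, h01, h10]

theorem posSemidef_adjugate_of_posDef {n : Type*} [Fintype n] [DecidableEq n] {S : Matrix n n ℂ}
    (hS : S.PosDef) : S.adjugate.PosSemidef := by
  have h : S.adjugate = S.det • S⁻¹ := by
    rw [Matrix.inv_def, smul_smul, Ring.mul_inverse_cancel _ hS.det_pos.ne'.isUnit, one_smul]
  rw [h]
  exact hS.inv.posSemidef.smul hS.det_pos.le

theorem det_smul_vecMulVec_star_add_smul_adjugate (S : Matrix (Fin 2) (Fin 2) ℂ)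
    (e : Fin 2 → ℂ) (a c : ℝ) :
    (a • vecMulVec e (star e) + c • S.adjugate).det =
      a * c * (star e ⬝ᵥ S.mulVec e) + c ^ 2 * S.det := by
  simp [adjugate_fin_two, det_fin_two, vecMulVec_apply, dotProduct, mulVec, Fin.sum_univ_two]
  ring

theorem trace_adjugate_fin_two (S : Matrix (Fin 2) (Fin 2) ℂ) : S.adjugate.trace = S.trace := by
  simp [adjugate_fin_two, trace_fin_two, add_comm]

theorem upperNumericalRange_nonempty_of_posDef {H S : Matrix (Fin 2) (Fin 2) ℂ}
    (hH : H.IsHermitian) (hS : S.PosDef) :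
    (upperNumericalRange (H + Complex.I • S)).Nonempty := by
  refine ⟨_, ⟨![1, 0], by simp [dotProduct], rfl⟩, ?_⟩
  change 0 ≤ Complex.im _
  rw [im_dotProduct_add_I_smul_mulVec hH]
  exact (Complex.le_def.1 (hS.posSemidef.dotProduct_mulVec_nonneg ![1, 0])).1

/-- The vector `z` enters only through `z z*`, which `det_mul_trace_mul_adjugate` eliminates in favour
of `y y*` and the fixed matrix `adj S`. The latter contributes the point
`v = tr (H adj S) / tr S`, where `tr S = tr (adj S)`. -/
theorem upperBild_subset_of_posDef {H S : Matrix (Fin 2) (Fin 2) ℂ} (hH : H.IsHermitian)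
    (hS : S.PosDef) :
    upperBild (toQuaternionMatrix (H + Complex.I • S)) ⊆
      convexHull ℝ (upperNumericalRange (H + Complex.I • S) ∪
        {(((H * S.adjugate).trace.re / S.trace.re : ℝ) : ℂ)}) := by
  rintro w ⟨hw, him⟩
  have hτ : 0 < S.trace.re := (Complex.lt_def.1 hS.trace_pos).1
  obtain ⟨X, ht, h01, rfl⟩ := (mem_bild_iff_exists_matrix hH hS.1 w).1 hw
  have hherm := isHermitian_conjTranspose_mul_mul X hS.1
  have hHherm := isHermitian_conjTranspose_mul_mul X hH
  have hpos := posSemidef_self_mul_conjTranspose X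
  have hle : ((Xᴴ * S * X) 1 1).re ≤ ((Xᴴ * S * X) 0 0).re := by
    have h : 0 ≤ ((H * (X * Xᴴ)).trace +
      Complex.I * ((Xᴴ * S * X) 0 0 - (Xᴴ * S * X) 1 1)).im := him
    rw [Complex.add_im, im_trace_mul_eq_zero hH hpos.1] at h
    simpa using h
  have hHadj := congrArg Complex.re (det_mul_trace_mul_adjugate hS.1 h01 H)
  have hadj := congrArg Complex.re (det_mul_trace_mul_adjugate hS.1 h01 1)
  have hone : (Xᴴ * 1 * X).IsHermitian := isHermitian_conjTranspose_mul_mul X isHermitian_one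
  rw [Matrix.one_mul, trace_adjugate_fin_two] at hadj
  simp only [Complex.add_re, Complex.mul_re, im_apply_self_eq_zero hherm,
    im_apply_self_eq_zero hHherm, im_apply_self_eq_zero hone,
    im_det_eq_zero hpos.1, zero_mul, sub_zero] at hHadj hadj
  rw [trace_mul_mul_conjTranspose]
  rw [trace_mul_conjTranspose_self] at ht
  have hg : 0 ≤ (X * Xᴴ).det.re := (Complex.le_def.1 hpos.det_nonneg).1
  generalize (X * Xᴴ).det.re = g at *
  simp only [conjTranspose_mul_mul_apply, one_mulVec] at *
  generalize X.col 0 = y at *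
  generalize X.col 1 = z at *
  have hy : y ≠ 0 := by
    rintro rfl
    rcases eq_or_ne z 0 with rfl | hz
    · simp at ht
    · have := (Complex.lt_def.1 (hS.dotProduct_mulVec_pos hz)).1
      simp at hle this
      linarith
  have hα : 0 < (star y ⬝ᵥ S.mulVec y).re :=
    (Complex.lt_def.1 (hS.dotProduct_mulVec_pos hy)).1
  obtain ⟨p, hp, hpe⟩ := exists_mem_numericalRange_smul (H + Complex.I • S) hy
  have hn := re_dotProduct_star_self_nonneg y
  have hβ : 0 ≤ (star z ⬝ᵥ S.mulVec z).re :=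
    (Complex.le_def.1 (hS.posSemidef.dotProduct_mulVec_nonneg z)).1
  have hsum : (star y ⬝ᵥ y).re + (star z ⬝ᵥ z).re = 1 := by
    rw [← Complex.add_re, ht, Complex.one_re]
  have hre := congrArg Complex.re hpe
  have hpim := congrArg Complex.im hpe
  rw [re_dotProduct_add_I_smul_mulVec H hS.1, Complex.smul_re, smul_eq_mul] at hre
  rw [im_dotProduct_add_I_smul_mulVec hH, Complex.smul_im, smul_eq_mul] at hpim
  have hp' : p ∈ upperNumericalRange (H + Complex.I • S) :=
    ⟨hp, nonneg_of_mul_nonneg_right (hpim ▸ hα.le) (by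
      refine hn.lt_of_ne fun h => hα.ne' ?_
      rw [hpim, ← h, zero_mul])⟩
  -- The point is `(1 - t) p + t v` with `t = det (X Xᴴ) * tr S / y* S y`, where `p` is the value
  -- of the form of `A` at the normalized `y`.
  have hmem := convex_convexHull ℝ (upperNumericalRange (H + Complex.I • S) ∪
      {(((H * S.adjugate).trace.re / S.trace.re : ℝ) : ℂ)})
    (subset_convexHull ℝ _ (Or.inl hp')) (subset_convexHull ℝ _ (Or.inr rfl))
    (mul_nonneg hn (sub_nonneg.2 ((div_le_one hα).2 hle)))
    (div_nonneg (mul_nonneg hg hτ.le) hα.le)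
    (by
      rw [hadj]
      field_simp
      linear_combination (star y ⬝ᵥ S.mulVec y).re * hsum)
  convert hmem using 1
  have hHy := im_dotProduct_mulVec_eq_zero hH y
  have hHz := im_dotProduct_mulVec_eq_zero hH z
  have hSy := im_dotProduct_mulVec_eq_zero hS.1 y
  have hSz := im_dotProduct_mulVec_eq_zero hS.1 z
  generalize star y ⬝ᵥ H.mulVec y = a at *
  generalize star z ⬝ᵥ H.mulVec z = b at *
  generalize star y ⬝ᵥ S.mulVec y = α at *
  generalize star z ⬝ᵥ S.mulVec z = β at *
  apply Complex.ext
  · simp only [Complex.add_re, Complex.I_mul_re, Complex.sub_im, hSy, hSz, Complex.smul_re,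
      Complex.ofReal_re, smul_eq_mul]
    field_simp
    linear_combination (α.re - β.re) * hre - hHadj
  · simp only [Complex.add_im, Complex.I_mul_im, Complex.sub_re, hHy, hHz, Complex.smul_im,
      Complex.ofReal_im, smul_eq_mul]
    field_simp
    linear_combination (α.re - β.re) * hpim

/-- The convex combination `a p + b v`, with `p = e* A e`, comes from the density matrix
`a e e* + b adj S / tr S`. -/
theorem subset_upperBild_of_posDef {H S : Matrix (Fin 2) (Fin 2) ℂ} (hH : H.IsHermitian)
    (hS : S.PosDef) :
    convexHull ℝ (upperNumericalRange (H + Complex.I • S) ∪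
        {(((H * S.adjugate).trace.re / S.trace.re : ℝ) : ℂ)}) ⊆
      upperBild (toQuaternionMatrix (H + Complex.I • S)) := by
  have hτ : 0 < S.trace.re := (Complex.lt_def.1 hS.trace_pos).1
  have hτ' : S.trace = (S.trace.re : ℂ) :=
    Complex.ext (by simp) (by simpa using (Complex.lt_def.1 hS.trace_pos).2.symm)
  rw [(convex_upperNumericalRange _).convexHull_union (convex_singleton _)
    (upperNumericalRange_nonempty_of_posDef hH hS) (Set.singleton_nonempty _)]
  intro w hw
  obtain ⟨p, ⟨⟨e, he, rfl⟩, -⟩, q, rfl, a, b, ha, hb, hab, rfl⟩ := mem_convexJoin.1 hw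
  rw [mem_upperBild_iff_exists_posSemidef hH hS.1]
  have hε := (Complex.le_def.1 (hS.posSemidef.dotProduct_mulVec_nonneg e)).1
  have hadj := posSemidef_adjugate_of_posDef hS
  have htr (M : Matrix (Fin 2) (Fin 2) ℂ) :
      (M * (a • vecMulVec e (star e) + (b / S.trace.re) • S.adjugate)).trace =
        a • (star e ⬝ᵥ M.mulVec e) + (b / S.trace.re) • (M * S.adjugate).trace := by
    rw [mul_add, trace_add, mul_smul_comm, mul_smul_comm, trace_smul, trace_smul,
      trace_mul_vecMulVec_star]
  have him : (a • (star e ⬝ᵥ (H + Complex.I • S).mulVec e) +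
      b • (((H * S.adjugate).trace.re / S.trace.re : ℝ) : ℂ)).im =
        a * (star e ⬝ᵥ S.mulVec e).re := by
    rw [Complex.add_im, Complex.smul_im, Complex.smul_im, im_dotProduct_add_I_smul_mulVec hH,
      Complex.ofReal_im, smul_zero, add_zero, smul_eq_mul]
  refine ⟨?_, a • vecMulVec e (star e) + (b / S.trace.re) • S.adjugate,
    ((posSemidef_vecMulVec_self_star e).smul ha).add (hadj.smul (div_nonneg hb hτ.le)),
    ?_, ?_, ?_⟩
  · rw [him]
    exact mul_nonneg ha hε
  · have h := htr 1
    rw [Matrix.one_mul, Matrix.one_mul, one_mulVec, he, trace_adjugate_fin_two, hτ'] at h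
    rw [Complex.ofReal_re] at h
    rw [h, Complex.real_smul, Complex.real_smul, mul_one, ← Complex.ofReal_mul,
      div_mul_cancel₀ _ hτ.ne', ← Complex.ofReal_add, hab, Complex.ofReal_one]
  · rw [htr]
    simp only [Complex.add_re, Complex.smul_re,
      re_dotProduct_add_I_smul_mulVec H hS.1, Complex.ofReal_re, smul_eq_mul]
    ring
  · rw [him, htr, det_smul_vecMulVec_star_add_smul_adjugate, mul_adjugate, trace_smul, trace_one]
    generalize b / S.trace.re = c
    have hd := im_det_eq_zero hS.1
    generalize star e ⬝ᵥ S.mulVec e = ε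
    simp [hd, ← Complex.ofReal_pow, ← Complex.ofReal_mul, mul_assoc]
    ring

end QuatNumRange

theorem corollary3p10 (A H S : Matrix (Fin 2) (Fin 2) ℂ)
    (hH : H.IsHermitian) (hS : S.IsHermitian) (hA : A = H + Complex.I • S) :
    (QuatNumRange.IsIndefinite S →
      QuatNumRange.upperBild (QuatNumRange.toQuaternionMatrix A) =
        convexHull ℝ (QuatNumRange.upperNumericalRange A ∪
          QuatNumRange.upperNumericalRange A.conjTranspose)) ∧
    (S.PosDef →
      ∃ v : ℝ, QuatNumRange.upperBild (QuatNumRange.toQuaternionMatrix A) =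
        convexHull ℝ (QuatNumRange.upperNumericalRange A ∪ {(v : ℂ)})) ∧
    (S.PosSemidef ∧ ¬ S.PosDef →
      QuatNumRange.upperBild (QuatNumRange.toQuaternionMatrix A) =
        QuatNumRange.upperNumericalRange A) := by
  subst hA
  exact ⟨fun h => (QuatNumRange.upperBild_subset_of_isIndefinite hH h).antisymm
      (QuatNumRange.subset_upperBild_of_isIndefinite hH h),
    fun h => ⟨_, (QuatNumRange.upperBild_subset_of_posDef hH h).antisymm
      (QuatNumRange.subset_upperBild_of_posDef hH h)⟩,
    fun h => QuatNumRange.upperBild_eq_of_posSemidef_of_not_posDef hH h.1 h.2⟩
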